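/- A partition is a finite nonincreasing sequence of positive integers (the empty sequence being the partition of $0$); it is a $3$-core if none of the hook numbers of its Young diagram is a multiple of $3$. For $n\ge 0$ let $B_3(n)$ denote the number of ordered triples $(\lambda_1,\lambda_2,\lambda_3)$ of partitions such that the sum of all the parts of $\lambda_1,\lambda_2,\lambda_3$ equals $n$ and each $\lambda_i$ is a $3$-core. Then for all integers $k\ge 1$ and $n\ge 0$ the number $\frac{4^{k+1}+(-1)^k}{5}$ is an integer and $$B_3\left(2^{k+1}n+2^k-1\right)\equiv 0 \pmod{\frac{4^{k+1}+(-1)^k}{5}}.$$ -/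

import Mathlib

/-! A partition `λ₁ ≥ λ₂ ≥ ⋯ ≥ λ_r > 0` is represented by its Young diagram, Mathlib's
`YoungDiagram` (see `YoungDiagram.equivListRowLens` for the bijection with nonincreasing lists of
positive integers).  The sum of the parts is the number of cells, `YoungDiagram.card`. -/

namespace PartitionTriples

/-- The hook number of the cell `(i, j)` (row `i`, column `j`, both counted from `0`) of `μ`:
the number of cells to its right in the same row, plus the number of cells below it in the same
column, plus one for the cell itself. -/
def hookNumber (μ : YoungDiagram) (i j : ℕ) : ℕ :=
  (μ.rowLen i - (j + 1)) + (μ.colLen j - (i + 1)) + 1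

/-- A partition is a `t`-core if none of its hook numbers is a multiple of `t`. -/
def IsCore (t : ℕ) (μ : YoungDiagram) : Prop :=
  ∀ i j : ℕ, (i, j) ∈ μ → ¬ t ∣ hookNumber μ i j

/-- The (ordered) partition triples of `n` with `t`-cores: all the parts of the three partitions
sum to `n`, and each of the partitions is a `t`-core. -/
def coreTriples (t n : ℕ) : Set (Fin 3 → YoungDiagram) :=
  {μ | ∑ r, (μ r).card = n ∧ ∀ r, IsCore t (μ r)}

/-- `B t n` is the number of partition triples of `n` with `t`-cores. -/
noncomputable def B (t n : ℕ) : ℕ :=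
  (coreTriples t n).ncard

theorem cells_subset_range (μ : YoungDiagram) :
    μ.cells ⊆ Finset.range μ.card ×ˢ Finset.range μ.card := by
  rintro ⟨i, j⟩ h
  have h' : (i, j) ∈ μ := h
  have hr : μ.rowLen i ≤ μ.card := by
    rw [YoungDiagram.rowLen_eq_card]
    exact Finset.card_le_card (Finset.filter_subset _ _)
  have hc : μ.colLen j ≤ μ.card := by
    rw [YoungDiagram.colLen_eq_card]
    exact Finset.card_le_card (Finset.filter_subset _ _)
  simp only [Finset.mem_product, Finset.mem_range]
  exact ⟨(YoungDiagram.mem_iff_lt_colLen.1 h').trans_le hc,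
    (YoungDiagram.mem_iff_lt_rowLen.1 h').trans_le hr⟩

/-- There are only finitely many partition triples of `n`, so `B t n` is a genuine count. -/
theorem coreTriples_finite (t n : ℕ) : (coreTriples t n).Finite := by
  have hfin : {μ : YoungDiagram | μ.card ≤ n}.Finite := by
    refine Set.Finite.of_finite_image (f := YoungDiagram.cells)
      ((Finset.finite_toSet (Finset.range n ×ˢ Finset.range n).powerset).subset ?_) ?_
    · rintro _ ⟨μ, hμ, rfl⟩
      simp only [Finset.coe_powerset, Set.mem_preimage, Set.mem_powerset_iff, Finset.coe_subset]
      exact (cells_subset_range μ).trans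
        (Finset.product_subset_product (Finset.range_mono hμ) (Finset.range_mono hμ))
    · intro μ _ ν _ h
      exact YoungDiagram.ext h
  refine (Set.Finite.pi' (fun _ : Fin 3 => hfin)).subset ?_
  rintro μ ⟨hμ, -⟩ r
  exact (Finset.single_le_sum (f := fun r => (μ r).card)
    (fun _ _ => Nat.zero_le _) (Finset.mem_univ r)).trans hμ.le

end PartitionTriples

/-! Write `T`, `P` for the theta series of the classes of 1 and 0 modulo 1 - ω in the Eisenstein
integers. Via beta sets, 3-cores correspond to pairs (a, b) of naturals, and 3·size + 1 is the norm
of an Eisenstein integer congruent to 1; these fill one third of that class. Hence the coefficient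
of `T ^ 3` at 3(n + 1) is 27 B₃(n) (`coeff_latTheta_one_pow_three`). The coefficients c of `T ^ 3`
satisfy the Hecke relation at 2, c(2n) = 3c(n) + 4c(n/2), where c(n/2) = 0 for odd n
(`coeff_two_mul_latTheta_pow_three`). The recurrence has roots 4 and -1, so 5c(2^k m) = (4^(k+1) +
(-1)^k) c(m) for odd m; taking m = 3(2n + 1) gives B₃(2^(k+1) n + 2^k - 1) as the modulus times
B₃(2n), an exact identity. The Hecke relation is obtained without modular forms. Splitting modulo 2
gives T = T(q⁴) + 3U with U odd, and the map (s, t) ↦ (s + t, s - t) evaluates 3U². The even part of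
`T ^ 3` then follows from 3 T T(q²) P = T³ + 4 T(q²)³, a consequence of two quadratic identities.
These hold because the differences of their sides, multiplied by U, are combinations of their own
images under q ↦ q², which forces infinite order of vanishing. -/

namespace PartitionTriples

open PowerSeries

/-! ### Generating series of weighted sets -/

/-- The generating series `∑_{v ∈ S} q ^ f v`. -/
noncomputable def theta {V : Type*} (S : Set V) (f : V → ℕ) : PowerSeries ℤ :=
  PowerSeries.mk fun n => (({v | v ∈ S ∧ f v = n}).ncard : ℤ)

section Theta

variable {V W : Type*}

theorem coeff_theta (S : Set V) (f : V → ℕ) (n : ℕ) :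
    coeff n (theta S f) = (({v | v ∈ S ∧ f v = n}).ncard : ℤ) := by
  simp [theta]

theorem theta_eq_of_bijOn {S : Set V} {T : Set W} {f : V → ℕ} {g : W → ℕ} (φ : V → W)
    (hφ : Set.BijOn φ S T) (hfg : ∀ v ∈ S, g (φ v) = f v) : theta S f = theta T g := by
  ext n
  rw [coeff_theta, coeff_theta]
  congr 1
  refine Set.BijOn.ncard_eq (f := φ) ⟨?_, ?_, ?_⟩
  · rintro v ⟨hv, hn⟩
    exact ⟨hφ.mapsTo hv, (hfg v hv).trans hn⟩
  · rintro v ⟨hv, -⟩ w ⟨hw, -⟩ h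
    exact hφ.injOn hv hw h
  · rintro w ⟨hw, hn⟩
    obtain ⟨v, hv, rfl⟩ := hφ.surjOn hw
    exact ⟨v, ⟨hv, (hfg v hv).symm.trans hn⟩, rfl⟩

/-- Finite fibres are needed because `ncard` is 0 on infinite sets. -/
theorem theta_union {S T : Set V} {f : V → ℕ} (hf : ∀ n, {v | f v = n}.Finite)
    (h : Disjoint S T) : theta (S ∪ T) f = theta S f + theta T f := by
  ext n
  rw [map_add, coeff_theta, coeff_theta, coeff_theta, ← Nat.cast_add, ← Set.ncard_union_eq ?_
    ((hf n).subset fun v hv => hv.2) ((hf n).subset fun v hv => hv.2)]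
  · congr 2
    ext v
    simp only [Set.mem_union, Set.mem_ofPred_eq]
    tauto
  · rw [Set.disjoint_left] at h ⊢
    rintro v ⟨hv, -⟩ ⟨hv', -⟩
    exact h hv hv'

theorem finite_fibers_add {f : V → ℕ} {g : W → ℕ} (hf : ∀ n, {v | f v = n}.Finite)
    (hg : ∀ n, {v | g v = n}.Finite) (n : ℕ) : {p : V × W | f p.1 + g p.2 = n}.Finite := by
  refine ((Set.finite_Iic n).biUnion fun i _ => (Set.finite_Iic n).biUnion fun j _ =>
    (hf i).prod (hg j)).subset ?_
  rintro ⟨v, w⟩ h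
  simp only [Set.mem_ofPred_eq] at h
  simp only [Set.mem_iUnion]
  exact ⟨f v, by simp; omega, g w, by simp; omega, rfl, rfl⟩

theorem theta_mul {f : V → ℕ} {g : W → ℕ} (hf : ∀ n, {v | f v = n}.Finite)
    (hg : ∀ n, {v | g v = n}.Finite) (S : Set V) (T : Set W) :
    theta S f * theta T g = theta (S ×ˢ T) (fun p => f p.1 + g p.2) := by
  ext n
  rw [coeff_mul, coeff_theta]
  have hfin : {p : V × W | p ∈ S ×ˢ T ∧ f p.1 + g p.2 = n}.Finite :=
    (finite_fibers_add hf hg n).subset fun p hp => hp.2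
  rw [Set.ncard_eq_toFinset_card _ hfin, Finset.card_eq_sum_card_fiberwise
    (f := fun p => (f p.1, g p.2)) (t := Finset.HasAntidiagonal.antidiagonal n)]
  · push_cast
    refine Finset.sum_congr rfl ?_
    rintro ⟨i, j⟩ hij
    rw [coeff_theta, coeff_theta, ← Nat.cast_mul, ← Set.ncard_prod, ← Set.ncard_coe_finset]
    congr 2
    rw [Finset.HasAntidiagonal.mem_antidiagonal] at hij
    ext ⟨v, w⟩
    simp only [Set.mem_prod, Set.mem_ofPred_eq, Finset.coe_filter, Set.Finite.mem_toFinset,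
      Prod.mk.injEq]
    constructor
    · rintro ⟨⟨h1, h2⟩, h3, h4⟩
      exact ⟨⟨⟨h1, h3⟩, by omega⟩, h2, h4⟩
    · rintro ⟨⟨⟨h1, h3⟩, -⟩, h2, h4⟩
      exact ⟨⟨h1, h2⟩, h3, h4⟩
  · intro p hp
    have hp' := (hfin.mem_toFinset.1 hp).2
    simpa using hp'

theorem expand_theta (m : ℕ) (hm : m ≠ 0) (S : Set V) (f : V → ℕ) :
    expand m hm (theta S f) = theta S (fun v => m * f v) := by
  ext n
  rw [coeff_expand]
  split_ifs with h
  · obtain ⟨k, rfl⟩ := h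
    rw [Nat.mul_div_cancel_left _ (Nat.pos_of_ne_zero hm), coeff_theta, coeff_theta]
    simp [hm]
  · have : {v | v ∈ S ∧ m * f v = n} = ∅ := by
      ext v
      simp only [Set.mem_ofPred_eq, Set.mem_empty_iff_false, iff_false, not_and]
      rintro _ rfl
      exact h (dvd_mul_right _ _)
    rw [coeff_theta, this, Set.ncard_empty, Nat.cast_zero]

/-- Used with ρ induced by ω: three pieces permuted cyclically contribute equally, and `S₀` is what
remains. -/
theorem theta_eq_add_three_mul {f : V → ℕ} (hf : ∀ n, {v | f v = n}.Finite) (ρ : V → V)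
    (hρ : ∀ v, f (ρ v) = f v) {S S₀ S₁ S₂ S₃ : Set V} (h₁₂ : Set.BijOn ρ S₁ S₂)
    (h₂₃ : Set.BijOn ρ S₂ S₃) (hS : ((S₀ ∪ S₁) ∪ S₂) ∪ S₃ = S) (h₁ : Disjoint S₀ S₁)
    (h₂ : Disjoint (S₀ ∪ S₁) S₂) (h₃ : Disjoint ((S₀ ∪ S₁) ∪ S₂) S₃) :
    theta S f = theta S₀ f + 3 * theta S₁ f := by
  rw [← hS, theta_union hf h₃, theta_union hf h₂, theta_union hf h₁,
    ← theta_eq_of_bijOn ρ h₂₃ fun v _ => hρ v, ← theta_eq_of_bijOn ρ h₁₂ fun v _ => hρ v]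
  ring

end Theta

/-! ### Eisenstein integers: classes modulo 1 - ω and splitting modulo 2 -/

/-- The norm `x² - x y + y²` of the Eisenstein integer `x + y ω`. -/
def normForm (v : ℤ × ℤ) : ℕ := (v.1 ^ 2 - v.1 * v.2 + v.2 ^ 2).toNat

theorem normForm_cast (v : ℤ × ℤ) : (normForm v : ℤ) = v.1 ^ 2 - v.1 * v.2 + v.2 ^ 2 :=
  Int.toNat_of_nonneg (by nlinarith [sq_nonneg (2 * v.1 - v.2), sq_nonneg v.2])

theorem normForm_finite (n : ℕ) : {v | normForm v = n}.Finite := by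
  refine ((Set.finite_Icc (-(2 * n : ℤ)) (2 * n)).prod
    (Set.finite_Icc (-(2 * n : ℤ)) (2 * n))).subset ?_
  rintro ⟨x, y⟩ h
  have h' := normForm_cast (x, y)
  rw [show normForm (x, y) = n from h] at h'
  simp only at h'
  simp only [Set.mem_prod, Set.mem_Icc]
  have hx : x ^ 2 ≤ 2 * n := by nlinarith [sq_nonneg (x - y), sq_nonneg y]
  have hy : y ^ 2 ≤ 2 * n := by nlinarith [sq_nonneg (x - y), sq_nonneg x]
  refine ⟨⟨?_, ?_⟩, ?_, ?_⟩ <;> nlinarith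

/-- Multiplication by `ω`. -/
def rot (v : ℤ × ℤ) : ℤ × ℤ := (-v.2, v.1 - v.2)

theorem normForm_rot (v : ℤ × ℤ) : normForm (rot v) = normForm v := by
  zify
  rw [normForm_cast, normForm_cast]
  simp only [rot]
  ring

/-- The Eisenstein integers congruent to `c` modulo `1 - ω`. -/
def lat (c : ℤ) : Set (ℤ × ℤ) := {v | (v.1 + v.2 - c) % 3 = 0}

/-- The elements of `lat c` congruent to `1` modulo `2`. -/
def oddLat (c : ℤ) : Set (ℤ × ℤ) := {v | (v.1 + v.2 - c) % 3 = 0 ∧ v.1 % 2 = 1 ∧ v.2 % 2 = 0}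

/-- The theta series of `lat c`. -/
noncomputable def latTheta (c : ℤ) : PowerSeries ℤ := theta (lat c) normForm

/-- The theta series of `oddLat c`. -/
noncomputable def oddTheta (c : ℤ) : PowerSeries ℤ := theta (oddLat c) normForm

/-- The substitution `q ↦ q²`. -/
noncomputable abbrev dbl : PowerSeries ℤ →ₐ[ℤ] PowerSeries ℤ := expand 2 two_ne_zero

theorem latTheta_congr {c d : ℤ} (h : (c - d) % 3 = 0) : latTheta c = latTheta d := by
  have : lat c = lat d := by
    ext v
    simp only [lat, Set.mem_ofPred_eq]
    omega
  rw [latTheta, latTheta, this]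

theorem latTheta_neg (c : ℤ) : latTheta (-c) = latTheta c := by
  refine theta_eq_of_bijOn (fun v => (-v.1, -v.2)) ⟨?_, ?_, ?_⟩ ?_
  · rintro ⟨x, y⟩ h
    simp only [lat, Set.mem_ofPred_eq] at h ⊢
    omega
  · rintro ⟨x, y⟩ - ⟨x', y'⟩ - h
    simpa using h
  · rintro ⟨x, y⟩ h
    simp only [lat, Set.mem_ofPred_eq] at h
    refine ⟨(-x, -y), ?_, by simp⟩
    simp only [lat, Set.mem_ofPred_eq]
    omega
  · rintro ⟨x, y⟩ -
    zify
    rw [normForm_cast, normForm_cast]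
    ring

/-- Multiplication by 2 quadruples the norm and acts as -1 modulo 3; the resulting sign is absorbed
by `latTheta_neg`. -/
theorem dbl_dbl_latTheta (c : ℤ) :
    dbl (dbl (latTheta c)) = theta {v | v ∈ lat c ∧ v.1 % 2 = 0 ∧ v.2 % 2 = 0} normForm := by
  rw [← latTheta_neg, latTheta, dbl, expand_theta, expand_theta]
  refine theta_eq_of_bijOn (fun v => (2 * v.1, 2 * v.2)) ⟨?_, ?_, ?_⟩ ?_
  · rintro ⟨x, y⟩ h
    simp only [lat, Set.mem_ofPred_eq] at h ⊢
    omega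
  · rintro ⟨x, y⟩ - ⟨x', y'⟩ - h
    simpa using h
  · rintro ⟨x, y⟩ h
    simp only [lat, Set.mem_ofPred_eq] at h
    refine ⟨(x / 2, y / 2), ?_, ?_⟩
    · simp only [lat, Set.mem_ofPred_eq]
      omega
    · simp only [Prod.mk.injEq]
      omega
  · rintro ⟨x, y⟩ -
    zify
    rw [normForm_cast, normForm_cast]
    ring

/-- Multiplication by ω preserves classes modulo 1 - ω and permutes cyclically the three nonzero
residues modulo 2. -/
theorem latTheta_eq (c : ℤ) : latTheta c = dbl (dbl (latTheta c)) + 3 * oddTheta c := by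
  rw [dbl_dbl_latTheta]
  refine theta_eq_add_three_mul normForm_finite rot normForm_rot
    (S₂ := {v | (v.1 + v.2 - c) % 3 = 0 ∧ v.1 % 2 = 0 ∧ v.2 % 2 = 1})
    (S₃ := {v | (v.1 + v.2 - c) % 3 = 0 ∧ v.1 % 2 = 1 ∧ v.2 % 2 = 1})
    ⟨?_, ?_, ?_⟩ ⟨?_, ?_, ?_⟩ ?_ ?_ ?_ ?_
  · rintro ⟨x, y⟩ h
    simp only [oddLat, rot, Set.mem_ofPred_eq] at h ⊢
    omega
  · rintro ⟨x, y⟩ - ⟨x', y'⟩ - h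
    simp only [rot, Prod.mk.injEq] at h ⊢
    omega
  · rintro ⟨x, y⟩ h
    simp only [Set.mem_ofPred_eq] at h
    refine ⟨(y - x, -x), ?_, ?_⟩
    · simp only [oddLat, Set.mem_ofPred_eq]
      omega
    · simp only [rot, Prod.mk.injEq]
      omega
  · rintro ⟨x, y⟩ h
    simp only [rot, Set.mem_ofPred_eq] at h ⊢
    omega
  · rintro ⟨x, y⟩ - ⟨x', y'⟩ - h
    simp only [rot, Prod.mk.injEq] at h ⊢
    omega
  · rintro ⟨x, y⟩ h
    simp only [Set.mem_ofPred_eq] at h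
    refine ⟨(y - x, -x), ?_, ?_⟩
    · simp only [Set.mem_ofPred_eq]
      omega
    · simp only [rot, Prod.mk.injEq]
      omega
  · ext ⟨x, y⟩
    simp only [oddLat, lat, Set.mem_union, Set.mem_ofPred_eq]
    omega
  all_goals
    rw [Set.disjoint_left]
    rintro ⟨x, y⟩ h h'
    simp only [oddLat, lat, Set.mem_union, Set.mem_ofPred_eq] at h h'
    omega

/-! ### Products of theta series via sums and differences -/

/-- The norm form on pairs. -/
def pairForm (p : (ℤ × ℤ) × (ℤ × ℤ)) : ℕ := normForm p.1 + normForm p.2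

theorem pairForm_finite (n : ℕ) : {p | pairForm p = n}.Finite :=
  finite_fibers_add normForm_finite normForm_finite n

theorem pairForm_cast (p : (ℤ × ℤ) × (ℤ × ℤ)) : (pairForm p : ℤ) =
    p.1.1 ^ 2 - p.1.1 * p.1.2 + p.1.2 ^ 2 + (p.2.1 ^ 2 - p.2.1 * p.2.2 + p.2.2 ^ 2) := by
  simp [pairForm, normForm_cast]

/-- The map `(s, t) ↦ (s + t, s - t)`. -/
def hadamard (p : (ℤ × ℤ) × (ℤ × ℤ)) : (ℤ × ℤ) × (ℤ × ℤ) :=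
  ((p.1.1 + p.2.1, p.1.2 + p.2.2), (p.1.1 - p.2.1, p.1.2 - p.2.2))

theorem pairForm_hadamard (p : (ℤ × ℤ) × (ℤ × ℤ)) : pairForm (hadamard p) = 2 * pairForm p := by
  zify
  rw [pairForm_cast, pairForm_cast]
  simp only [hadamard]
  ring

theorem latTheta_mul (c d : ℤ) :
    latTheta c * latTheta d = theta (lat c ×ˢ lat d) pairForm :=
  theta_mul normForm_finite normForm_finite _ _

/-- Two elements that are both 1 modulo 2 have integral half-sum and half-difference, which add up
to an element that is again 1 modulo 2. Halving is -1 modulo 3, which the negation in `hadamard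
(-p)` compensates. -/
theorem oddTheta_mul (c d : ℤ) :
    oddTheta c * oddTheta d = dbl (theta {p | p.1 ∈ lat (c + d) ∧ p.2 ∈ lat (c - d) ∧
      (p.1.1 + p.2.1) % 2 = 1 ∧ (p.1.2 + p.2.2) % 2 = 0} pairForm) := by
  rw [expand_theta, oddTheta, oddTheta, theta_mul normForm_finite normForm_finite]
  refine (theta_eq_of_bijOn (fun p => hadamard (-p)) ⟨?_, ?_, ?_⟩ ?_).symm
  · rintro ⟨⟨x, y⟩, ⟨z, w⟩⟩ h
    simp only [lat, oddLat, hadamard, Set.mem_ofPred_eq, Set.mem_prod, Prod.neg_mk] at h ⊢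
    omega
  · rintro ⟨⟨x, y⟩, ⟨z, w⟩⟩ - ⟨⟨x', y'⟩, ⟨z', w'⟩⟩ - h
    simp only [hadamard, Prod.mk.injEq, Prod.neg_mk] at h ⊢
    omega
  · rintro ⟨⟨x, y⟩, ⟨z, w⟩⟩ h
    simp only [oddLat, Set.mem_ofPred_eq, Set.mem_prod] at h
    refine ⟨((-((x + z) / 2), -((y + w) / 2)), (-((x - z) / 2), -((y - w) / 2))), ?_, ?_⟩
    · simp only [lat, Set.mem_ofPred_eq]
      omega
    · simp only [hadamard, Prod.mk.injEq, Prod.neg_mk]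
      omega
  · intro p _
    change pairForm _ = _
    rw [pairForm_hadamard]
    congr 1
    zify
    rw [pairForm_cast, pairForm_cast]
    simp

/-- The image of (s, t) ↦ (s + t, s - t) consists of the pairs congruent modulo 2, and the form
doubles. -/
theorem theta_even_pairs (c d : ℤ) :
    dbl (latTheta c * latTheta d) = theta {p | p.1 ∈ lat (c + d) ∧ p.2 ∈ lat (c - d) ∧
      (p.1.1 + p.2.1) % 2 = 0 ∧ (p.1.2 + p.2.2) % 2 = 0} pairForm := by
  rw [latTheta_mul, expand_theta]
  refine theta_eq_of_bijOn hadamard ⟨?_, ?_, ?_⟩ ?_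
  · rintro ⟨⟨x, y⟩, ⟨z, w⟩⟩ h
    simp only [lat, hadamard, Set.mem_ofPred_eq, Set.mem_prod] at h ⊢
    omega
  · rintro ⟨⟨x, y⟩, ⟨z, w⟩⟩ - ⟨⟨x', y'⟩, ⟨z', w'⟩⟩ - h
    simp only [hadamard, Prod.mk.injEq] at h ⊢
    omega
  · rintro ⟨⟨x, y⟩, ⟨z, w⟩⟩ h
    simp only [lat, Set.mem_ofPred_eq] at h
    refine ⟨(((x + z) / 2, (y + w) / 2), ((x - z) / 2, (y - w) / 2)), ?_, ?_⟩
    · simp only [lat, Set.mem_ofPred_eq, Set.mem_prod]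
      omega
    · simp only [hadamard, Prod.mk.injEq]
      omega
  · intro p _
    exact pairForm_hadamard p

/-- Rotating both components by ω permutes the nonzero residues of their sum modulo 2. -/
theorem theta_odd_pairs (c d : ℤ) :
    latTheta c * latTheta d = theta {p | p.1 ∈ lat c ∧ p.2 ∈ lat d ∧
      (p.1.1 + p.2.1) % 2 = 0 ∧ (p.1.2 + p.2.2) % 2 = 0} pairForm +
    3 * theta {p | p.1 ∈ lat c ∧ p.2 ∈ lat d ∧
      (p.1.1 + p.2.1) % 2 = 1 ∧ (p.1.2 + p.2.2) % 2 = 0} pairForm := by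
  rw [latTheta_mul]
  refine theta_eq_add_three_mul pairForm_finite (fun p => (rot p.1, rot p.2))
    (fun p => by simp [pairForm, normForm_rot])
    (S₂ := {p | p.1 ∈ lat c ∧ p.2 ∈ lat d ∧
      (p.1.1 + p.2.1) % 2 = 0 ∧ (p.1.2 + p.2.2) % 2 = 1})
    (S₃ := {p | p.1 ∈ lat c ∧ p.2 ∈ lat d ∧
      (p.1.1 + p.2.1) % 2 = 1 ∧ (p.1.2 + p.2.2) % 2 = 1})
    ⟨?_, ?_, ?_⟩ ⟨?_, ?_, ?_⟩ ?_ ?_ ?_ ?_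
  · rintro ⟨⟨x, y⟩, ⟨z, w⟩⟩ h
    simp only [lat, rot, Set.mem_ofPred_eq] at h ⊢
    omega
  · rintro ⟨⟨x, y⟩, ⟨z, w⟩⟩ - ⟨⟨x', y'⟩, ⟨z', w'⟩⟩ - h
    simp only [rot, Prod.mk.injEq] at h ⊢
    omega
  · rintro ⟨⟨x, y⟩, ⟨z, w⟩⟩ h
    simp only [lat, Set.mem_ofPred_eq] at h
    refine ⟨((y - x, -x), (w - z, -z)), ?_, ?_⟩
    · simp only [lat, Set.mem_ofPred_eq]
      omega
    · simp only [rot, Prod.mk.injEq]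
      omega
  · rintro ⟨⟨x, y⟩, ⟨z, w⟩⟩ h
    simp only [lat, rot, Set.mem_ofPred_eq] at h ⊢
    omega
  · rintro ⟨⟨x, y⟩, ⟨z, w⟩⟩ - ⟨⟨x', y'⟩, ⟨z', w'⟩⟩ - h
    simp only [rot, Prod.mk.injEq] at h ⊢
    omega
  · rintro ⟨⟨x, y⟩, ⟨z, w⟩⟩ h
    simp only [lat, Set.mem_ofPred_eq] at h
    refine ⟨((y - x, -x), (w - z, -z)), ?_, ?_⟩
    · simp only [lat, Set.mem_ofPred_eq]
      omega
    · simp only [rot, Prod.mk.injEq]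
      omega
  · ext ⟨⟨x, y⟩, ⟨z, w⟩⟩
    simp only [lat, Set.mem_union, Set.mem_ofPred_eq, Set.mem_prod]
    omega
  all_goals
    rw [Set.disjoint_left]
    rintro ⟨⟨x, y⟩, ⟨z, w⟩⟩ h h'
    simp only [Set.mem_union, Set.mem_ofPred_eq] at h h'
    omega

/-- Three times the pairs with sum 1 modulo 2 are all pairs minus the pairs with even sum, and both
of these are products of theta series. -/
theorem three_mul_oddTheta_mul (c d : ℤ) :
    3 * (oddTheta c * oddTheta d) =
      dbl (latTheta (c + d) * latTheta (c - d)) - dbl (dbl (latTheta c * latTheta d)) := by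
  rw [oddTheta_mul, theta_odd_pairs (c + d), theta_even_pairs, map_add, map_mul dbl 3, map_ofNat]
  ring

theorem coeff_oddTheta_of_even (c : ℤ) {n : ℕ} (hn : Even n) : coeff n (oddTheta c) = 0 := by
  rw [oddTheta, coeff_theta]
  have : {v | v ∈ oddLat c ∧ normForm v = n} = ∅ := by
    ext ⟨x, y⟩
    simp only [oddLat, Set.mem_ofPred_eq, Set.mem_empty_iff_false, iff_false, not_and]
    rintro ⟨-, hx, hy⟩ h
    have h' := normForm_cast (x, y)
    rw [h] at h'
    simp only at h'
    obtain ⟨m, rfl⟩ := hn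
    obtain ⟨a, rfl⟩ : ∃ a, x = 2 * a + 1 := ⟨x / 2, by omega⟩
    obtain ⟨b, rfl⟩ : ∃ b, y = 2 * b := ⟨y / 2, by omega⟩
    push_cast at h'
    have : (2 : ℤ) * (m - (2 * a ^ 2 + 2 * a - 2 * a * b - b + 2 * b ^ 2)) = 1 := by linarith
    omega
  simp [this]

/-- With `coeff_oddTheta_of_even` this makes `oddTheta 1` vanish to order exactly one, so dividing
by it costs a single power of q. -/
theorem coeff_one_oddTheta_ne_zero : coeff 1 (oddTheta 1) ≠ 0 := by
  rw [oddTheta, coeff_theta]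
  norm_cast
  refine Set.ncard_ne_zero_of_mem (a := ((1 : ℤ), (0 : ℤ))) ?_ ((normForm_finite 1).subset fun v h => h.2)
  simp [oddLat, normForm]

theorem coeff_zero_latTheta_one : coeff 0 (latTheta 1) = 0 := by
  rw [latTheta, coeff_theta]
  have : {v | v ∈ lat 1 ∧ normForm v = 0} = ∅ := by
    ext ⟨x, y⟩
    simp only [lat, Set.mem_ofPred_eq, Set.mem_empty_iff_false, iff_false, not_and]
    intro hxy h
    have h' := normForm_cast (x, y)
    rw [h] at h'
    simp only [Nat.cast_zero] at h'
    have hx : x = 0 := by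
      have : x ^ 2 = 0 := by nlinarith [sq_nonneg (x - y), sq_nonneg x, sq_nonneg y, sq_nonneg (x - 2 * y)]
      simpa using this
    have hy : y = 0 := by
      have : y ^ 2 = 0 := by nlinarith [sq_nonneg (x - y), sq_nonneg x, sq_nonneg y]
      simpa using this
    omega
  simp [this]

/-! ### Two quadratic theta identities by descent under q ↦ q² -/

/-- The obstruction `T (P - P(q²)) - 2 T(q²)²` to the first theta identity. -/
noncomputable def defectOne : PowerSeries ℤ :=
  latTheta 1 * (latTheta 0 - dbl (latTheta 0)) - 2 * dbl (latTheta 1) ^ 2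

/-- The obstruction `T(q²) (P + 2 P(q²)) - T²` to the second theta identity. -/
noncomputable def defectTwo : PowerSeries ℤ :=
  dbl (latTheta 1) * (latTheta 0 + 2 * dbl (latTheta 0)) - latTheta 1 ^ 2

theorem three_mul_oddTheta_one_sq : 3 * oddTheta 1 ^ 2 =
    dbl (latTheta 1) * dbl (latTheta 0) - dbl (dbl (latTheta 1)) ^ 2 := by
  have h := three_mul_oddTheta_mul 1 1
  rw [latTheta_congr (c := 1 + 1) (d := -1) (by norm_num), latTheta_neg,
    latTheta_congr (c := 1 - 1) (d := 0) (by norm_num)] at h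
  simp only [map_mul] at h
  linear_combination h

theorem three_mul_oddTheta_one_mul_zero : 3 * (oddTheta 1 * oddTheta 0) =
    dbl (latTheta 1) ^ 2 - dbl (dbl (latTheta 1)) * dbl (dbl (latTheta 0)) := by
  have h := three_mul_oddTheta_mul 1 0
  rw [latTheta_congr (c := 1 + 0) (d := 1) (by norm_num),
    latTheta_congr (c := 1 - 0) (d := 1) (by norm_num)] at h
  simp only [map_mul] at h
  linear_combination h

theorem oddTheta_mul_defectOne : oddTheta 1 * defectOne =
    -(oddTheta 1 * dbl defectTwo + dbl (dbl (latTheta 1)) * dbl defectTwo +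
      dbl (latTheta 0) * dbl defectOne) := by
  have h1 := latTheta_eq 1
  have h0 := latTheta_eq 0
  have h11 := three_mul_oddTheta_one_sq
  have h10 := three_mul_oddTheta_one_mul_zero
  simp only [defectOne, defectTwo, map_sub, map_mul, map_add, map_pow, map_ofNat]
  generalize dbl (dbl (latTheta 1)) = T₄ at *
  generalize dbl (dbl (latTheta 0)) = P₄ at *
  generalize dbl (latTheta 1) = T₂ at *
  generalize dbl (latTheta 0) = P₂ at *
  rw [h1, h0]
  generalize oddTheta 1 = U at *
  generalize oddTheta 0 = V at *
  -- `V` enters only through 3UV, which `h10` eliminates; the remaining U² terms are removed by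
  -- `h11`.
  linear_combination (3 * U + T₄) * h10 - (P₂ - P₄) * h11

theorem oddTheta_mul_defectTwo : oddTheta 1 * defectTwo =
    -(oddTheta 1 * dbl defectOne + dbl (latTheta 1) * dbl defectTwo +
      dbl (dbl (latTheta 1)) * dbl defectOne) := by
  have h1 := latTheta_eq 1
  have h0 := latTheta_eq 0
  have h11 := three_mul_oddTheta_one_sq
  have h10 := three_mul_oddTheta_one_mul_zero
  simp only [defectOne, defectTwo, map_sub, map_mul, map_add, map_pow, map_ofNat]
  generalize dbl (dbl (latTheta 1)) = T₄ at *
  generalize dbl (dbl (latTheta 0)) = P₄ at *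
  generalize dbl (latTheta 1) = T₂ at *
  generalize dbl (latTheta 0) = P₂ at *
  rw [h1, h0]
  generalize oddTheta 1 = U at *
  generalize oddTheta 0 = V at *
  linear_combination T₂ * h10 - (3 * U + 2 * T₄) * h11

theorem X_pow_dvd_dbl {n : ℕ} {f : PowerSeries ℤ} (h : X ^ n ∣ f) : X ^ (2 * n) ∣ dbl f := by
  obtain ⟨g, rfl⟩ := h
  rw [map_mul, map_pow, expand_X, ← pow_mul]
  exact dvd_mul_right _ _

theorem X_pow_dvd_of_dvd_oddTheta_mul {n : ℕ} {f : PowerSeries ℤ}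
    (h : X ^ (n + 1) ∣ oddTheta 1 * f) : X ^ n ∣ f := by
  obtain ⟨u, hu⟩ : (X : PowerSeries ℤ) ∣ oddTheta 1 := by
    rw [X_dvd_iff, ← coeff_zero_eq_constantCoeff_apply]
    exact coeff_oddTheta_of_even 1 (by simp)
  have hu' : ¬ (X : PowerSeries ℤ) ∣ u := by
    intro h
    apply coeff_one_oddTheta_ne_zero
    rw [hu, show 1 = 0 + 1 from rfl, coeff_succ_X_mul]
    simpa [X_dvd_iff] using h
  rw [hu, pow_succ', mul_assoc] at h
  exact X_prime.pow_dvd_of_dvd_mul_left n hu' ((mul_dvd_mul_iff_left X_ne_zero).1 h)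

theorem X_dvd_latTheta_one : (X : PowerSeries ℤ) ∣ latTheta 1 := by
  rw [X_dvd_iff, ← coeff_zero_eq_constantCoeff_apply]
  exact coeff_zero_latTheta_one

/-- The substitution q ↦ q² doubles the order of vanishing and cancelling `oddTheta 1` loses one:
order m becomes 2m - 1, a gain once m ≥ 2. Hence the induction starts at order 2. -/
theorem X_pow_dvd_defect (n : ℕ) : X ^ (n + 2) ∣ defectOne ∧ X ^ (n + 2) ∣ defectTwo := by
  induction n with
  | zero =>
    have hT := X_dvd_latTheta_one
    have hT2 : X ^ 2 ∣ dbl (latTheta 1) := by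
      simpa using X_pow_dvd_dbl (n := 1) (by simpa using hT)
    have hP : (X : PowerSeries ℤ) ∣ latTheta 0 - dbl (latTheta 0) := by
      rw [X_dvd_iff, map_sub, constantCoeff_expand, sub_self]
    refine ⟨dvd_sub ?_ ?_, dvd_sub ?_ ?_⟩
    · rw [zero_add, pow_two]
      exact mul_dvd_mul hT hP
    · exact (hT2.trans (dvd_pow_self _ two_ne_zero)).mul_left _
    · exact hT2.mul_right _
    · exact pow_dvd_pow_of_dvd hT 2
  | succ n ih =>
    have h1 : X ^ (n + 1 + 2 + 1) ∣ dbl defectOne :=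
      (pow_dvd_pow _ (by omega)).trans (X_pow_dvd_dbl ih.1)
    have h2 : X ^ (n + 1 + 2 + 1) ∣ dbl defectTwo :=
      (pow_dvd_pow _ (by omega)).trans (X_pow_dvd_dbl ih.2)
    constructor <;> apply X_pow_dvd_of_dvd_oddTheta_mul
    · rw [oddTheta_mul_defectOne, dvd_neg]
      exact dvd_add (dvd_add (h2.mul_left _) (h2.mul_left _)) (h1.mul_left _)
    · rw [oddTheta_mul_defectTwo, dvd_neg]
      exact dvd_add (dvd_add (h1.mul_left _) (h2.mul_left _)) (h1.mul_left _)

theorem eq_zero_of_X_pow_dvd {f : PowerSeries ℤ} (h : ∀ n, X ^ (n + 2) ∣ f) : f = 0 := by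
  ext n
  exact X_pow_dvd_iff.1 (h n) n (by omega)

theorem three_mul_latTheta_one_mul : 3 * latTheta 1 * dbl (latTheta 1) * latTheta 0 =
    latTheta 1 ^ 3 + 4 * dbl (latTheta 1) ^ 3 := by
  have h1 := eq_zero_of_X_pow_dvd fun n => (X_pow_dvd_defect n).1
  have h2 := eq_zero_of_X_pow_dvd fun n => (X_pow_dvd_defect n).2
  rw [defectOne] at h1
  rw [defectTwo] at h2
  -- This combination is chosen so that the terms in P(q²) cancel.
  linear_combination latTheta 1 * h2 + 2 * dbl (latTheta 1) * h1

/-! ### The Hecke relation at 2 -/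

/-- Expanding (T(q⁴) + 3U)³ and reducing U² splits the cube by parity: the first summand is even in
q, the second odd. -/
theorem latTheta_one_pow_three : latTheta 1 ^ 3 =
    dbl (3 * latTheta 1 ^ 3 + 4 * dbl (latTheta 1) ^ 3) + oddTheta 1 *
      dbl (9 * (latTheta 1 * latTheta 0)) := by
  have h1 := latTheta_eq 1
  have h11 := three_mul_oddTheta_one_sq
  have h := congrArg dbl three_mul_latTheta_one_mul
  simp only [map_mul, map_add, map_pow, map_ofNat] at h ⊢
  generalize dbl (dbl (latTheta 1)) = T₄ at *
  generalize dbl (latTheta 1) = T₂ at *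
  generalize dbl (latTheta 0) = P₂ at *
  rw [h1]
  generalize oddTheta 1 = U at *
  linear_combination 9 * (T₄ + U) * h11 + 3 * h

theorem coeff_two_mul_oddTheta_mul_dbl (f : PowerSeries ℤ) (n : ℕ) :
    coeff (2 * n) (oddTheta 1 * dbl f) = 0 := by
  rw [coeff_mul]
  refine Finset.sum_eq_zero ?_
  rintro ⟨i, j⟩ hij
  rw [Finset.HasAntidiagonal.mem_antidiagonal] at hij
  simp only at hij ⊢
  rcases Nat.even_or_odd i with hi | hi
  · rw [coeff_oddTheta_of_even 1 hi, zero_mul]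
  · rw [coeff_expand_of_not_dvd 2 two_ne_zero, mul_zero]
    obtain ⟨k, rfl⟩ := hi
    omega

theorem coeff_two_mul_latTheta_pow_three (n : ℕ) : coeff (2 * n) (latTheta 1 ^ 3) =
    3 * coeff n (latTheta 1 ^ 3) + 4 * coeff n (dbl (latTheta 1 ^ 3)) := by
  conv_lhs => rw [latTheta_one_pow_three]
  rw [map_add, coeff_two_mul_oddTheta_mul_dbl, add_zero, coeff_expand_mul, map_add, map_pow dbl]
  simp only [← nsmul_eq_mul, ← Nat.cast_ofNat (R := PowerSeries ℤ), map_nsmul]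
  simp

/-- The closed form solves x² = 3x + 4, with roots 4 and -1. Oddness of m kills the c(m/2) term in
the first step. -/
theorem five_mul_coeff_latTheta_pow_three {m : ℕ} (hm : Odd m) (k : ℕ) :
    5 * coeff (2 ^ k * m) (latTheta 1 ^ 3) =
      (4 ^ (k + 1) + (-1) ^ k) * coeff m (latTheta 1 ^ 3) := by
  induction k using Nat.twoStepInduction with
  | zero => simp
  | one =>
    rw [pow_one, coeff_two_mul_latTheta_pow_three, coeff_expand_of_not_dvd]
    · ring
    · obtain ⟨k, rfl⟩ := hm
      omega
  | more k h0 h1 =>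
    rw [pow_succ', mul_assoc, coeff_two_mul_latTheta_pow_three]
    rw [show coeff (2 ^ (k + 1) * m) (dbl (latTheta 1 ^ 3)) = coeff (2 ^ k * m) (latTheta 1 ^ 3) by
      rw [pow_succ', mul_assoc, coeff_expand_mul]]
    linear_combination 3 * h1 + 4 * h0

/-! ### Beta sets and hook numbers -/

section BetaSet

variable {μ ν : YoungDiagram}

/-- The first-column hook number of row `i`. -/
def betaNum (μ : YoungDiagram) (i : ℕ) : ℕ := μ.rowLen i + (μ.colLen 0 - 1 - i)

/-- The set of first-column hook numbers. -/
def betaSet (μ : YoungDiagram) : Finset ℕ := (Finset.range (μ.colLen 0)).image (betaNum μ)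

theorem rowLen_pos_iff {i : ℕ} : 0 < μ.rowLen i ↔ i < μ.colLen 0 := by
  rw [← YoungDiagram.mem_iff_lt_rowLen, YoungDiagram.mem_iff_lt_colLen]

theorem lt_rowLen_iff {i j : ℕ} : j < μ.rowLen i ↔ i < μ.colLen j := by
  rw [← YoungDiagram.mem_iff_lt_rowLen, YoungDiagram.mem_iff_lt_colLen]

theorem betaNum_lt {i j : ℕ} (hij : i < j) (hj : j < μ.colLen 0) : betaNum μ j < betaNum μ i := by
  have := μ.rowLen_anti i j hij.le
  unfold betaNum
  omega

theorem betaNum_injOn : Set.InjOn (betaNum μ) (Finset.range (μ.colLen 0)) := by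
  intro i hi j hj h
  simp only [Finset.coe_range, Set.mem_Iio] at hi hj
  rcases lt_trichotomy i j with hij | hij | hij
  · exact absurd h (betaNum_lt hij hj).ne'
  · exact hij
  · exact absurd h (betaNum_lt hij hi).ne

theorem card_betaSet (μ : YoungDiagram) : (betaSet μ).card = μ.colLen 0 := by
  rw [betaSet, Finset.card_image_of_injOn betaNum_injOn, Finset.card_range]

theorem zero_notMem_betaSet (μ : YoungDiagram) : 0 ∉ betaSet μ := by
  simp only [betaSet, Finset.mem_image, Finset.mem_range, not_exists, not_and]
  intro i hi
  have := rowLen_pos_iff.2 hi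
  unfold betaNum
  omega

/-- The `j`-th natural number outside the beta set. -/
def gap (μ : YoungDiagram) (j : ℕ) : ℕ := j + (μ.colLen 0 - μ.colLen j)

/-- The hooks in row i are the differences between its beta number and the smaller naturals missing
from the beta set. -/
theorem hookNumber_add_gap {i j : ℕ} (h : (i, j) ∈ μ) :
    hookNumber μ i j + gap μ j = betaNum μ i := by
  have h1 := YoungDiagram.mem_iff_lt_rowLen.1 h
  have h2 := YoungDiagram.mem_iff_lt_colLen.1 h
  have h3 := μ.colLen_anti 0 j (Nat.zero_le _)
  unfold hookNumber gap betaNum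
  omega

theorem betaNum_lt_gap {i j : ℕ} (hi : i < μ.colLen 0) (h : (i, j) ∉ μ) :
    betaNum μ i < gap μ j := by
  have h1 := mt YoungDiagram.mem_iff_lt_rowLen.2 h
  have h2 := mt YoungDiagram.mem_iff_lt_colLen.2 h
  unfold gap betaNum
  omega

theorem gap_notMem_betaSet (μ : YoungDiagram) (j : ℕ) : gap μ j ∉ betaSet μ := by
  simp only [betaSet, Finset.mem_image, Finset.mem_range, not_exists, not_and]
  intro i hi
  by_cases h : (i, j) ∈ μ
  · have := hookNumber_add_gap h
    unfold hookNumber at this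
    omega
  · exact (betaNum_lt_gap hi h).ne

theorem exists_gap_eq {m : ℕ} (hm : m ∉ betaSet μ) : ∃ j, gap μ j = m := by
  have hne : ∀ i < μ.colLen 0, betaNum μ i ≠ m := by
    simpa [betaSet] using hm
  -- The least such t counts the rows whose beta number exceeds m; it will be the length of the
  -- column sought.
  have hex : ∃ t, μ.colLen 0 ≤ t ∨ betaNum μ t < m := ⟨_, Or.inl le_rfl⟩
  classical
  obtain ⟨t, ht, hmin⟩ : ∃ t, (μ.colLen 0 ≤ t ∨ betaNum μ t < m) ∧
      ∀ s < t, s < μ.colLen 0 ∧ m < betaNum μ s := by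
    refine ⟨Nat.find hex, Nat.find_spec hex, fun s hs => ?_⟩
    have := Nat.find_min hex hs
    push Not at this
    exact ⟨this.1, lt_of_le_of_ne this.2 (hne s this.1).symm⟩
  have htr : t ≤ μ.colLen 0 := by
    by_contra! h
    exact lt_irrefl _ (hmin _ h).1
  have hle : μ.colLen 0 - t ≤ m := by
    rcases ht with ht | ht
    · omega
    · rcases htr.lt_or_eq with h | h
      · have := rowLen_pos_iff.2 h
        unfold betaNum at ht
        omega
      · omega
  refine ⟨m - (μ.colLen 0 - t), ?_⟩
  have hcol : μ.colLen (m - (μ.colLen 0 - t)) = t := by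
    refine eq_of_forall_lt_iff fun s => ?_
    rw [← lt_rowLen_iff]
    constructor
    · intro h
      by_contra! hts
      have h1 := μ.rowLen_anti t s hts
      have h2 : t < μ.colLen 0 := rowLen_pos_iff.1 (by omega)
      have h3 := ht.resolve_left (by omega)
      unfold betaNum at h3
      omega
    · intro h
      have h1 := μ.rowLen_anti s (t - 1) (by omega)
      have h2 := hmin (t - 1) (by omega)
      unfold betaNum at h2
      omega
  rw [gap, hcol]
  omega

/-- A hook equal to t is an element whose translate by -t is missing. For a hook t·k, closure under
subtracting t applies k times. -/
theorem isCore_iff {t : ℕ} : IsCore t μ ↔ ∀ m, m + t ∈ betaSet μ → m ∈ betaSet μ := by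
  constructor
  · intro h m hm
    by_contra hm'
    obtain ⟨j, rfl⟩ := exists_gap_eq hm'
    obtain ⟨i, hi, hij⟩ := Finset.mem_image.1 hm
    rw [Finset.mem_range] at hi
    by_cases hmem : (i, j) ∈ μ
    · have := hookNumber_add_gap hmem
      refine h i j hmem ⟨1, ?_⟩
      omega
    · have := betaNum_lt_gap hi hmem
      omega
  · rintro h i j hij ⟨k, hk⟩
    have hk' := hookNumber_add_gap hij
    have hi : i < μ.colLen 0 := (YoungDiagram.mem_iff_lt_colLen.1 hij).trans_le
      (μ.colLen_anti 0 j (Nat.zero_le _))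
    have key : ∀ k, gap μ j + t * k ∈ betaSet μ → gap μ j ∈ betaSet μ := by
      intro k
      induction k with
      | zero => simp
      | succ k ih =>
        intro h'
        exact ih (h _ (by rwa [Nat.mul_succ, ← add_assoc] at h'))
    refine gap_notMem_betaSet μ j (key k ?_)
    rw [← hk, add_comm, hk']
    exact Finset.mem_image_of_mem _ (Finset.mem_range.2 hi)

/-- Listed increasingly, the beta set has k-th element k plus the k-th smallest part; this recovers
the partition. -/
theorem rowLen_add_eq_orderEmbOfFin {S : Finset ℕ} {r : ℕ} (h : S.card = r)
    (hμ : betaSet μ = S) (k : Fin r) : μ.rowLen (r - 1 - k) + k = S.orderEmbOfFin h k := by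
  have hr : μ.colLen 0 = r := by rw [← card_betaSet, hμ, h]
  have hb : ∀ k : Fin r, μ.rowLen (r - 1 - k) + k = betaNum μ (r - 1 - k) := by
    intro k
    unfold betaNum
    omega
  refine congrFun (Finset.orderEmbOfFin_unique h (f := fun k : Fin r => μ.rowLen (r - 1 - k) + k)
    (fun k => ?_) (fun k l hkl => ?_)) k
  · rw [hb, ← hμ]
    exact Finset.mem_image_of_mem _ (Finset.mem_range.2 (by omega))
  · have : (k : ℕ) < l := hkl
    simp only [hb]
    exact betaNum_lt (by omega) (by omega)

theorem betaSet_injective : Function.Injective betaSet := by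
  intro μ ν h
  have hr : μ.colLen 0 = ν.colLen 0 := by rw [← card_betaSet, h, card_betaSet]
  have hrow : ∀ i, μ.rowLen i = ν.rowLen i := by
    intro i
    by_cases hi : i < ν.colLen 0
    · have h1 := rowLen_add_eq_orderEmbOfFin (card_betaSet ν) h ⟨ν.colLen 0 - 1 - i, by omega⟩
      rw [← rowLen_add_eq_orderEmbOfFin (card_betaSet ν) rfl] at h1
      simpa [show ν.colLen 0 - 1 - (ν.colLen 0 - 1 - i) = i by omega] using h1
    · have h1 := mt rowLen_pos_iff.1 hi
      have h2 := mt rowLen_pos_iff.1 (hr ▸ hi)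
      omega
  ext ⟨i, j⟩
  rw [YoungDiagram.mem_cells, YoungDiagram.mem_cells, YoungDiagram.mem_iff_lt_rowLen,
    YoungDiagram.mem_iff_lt_rowLen, hrow]

theorem exists_rowLen_eq {f : ℕ → ℕ} (hf : Antitone f) {r : ℕ} (hr : ∀ i, 0 < f i ↔ i < r) :
    ∃ μ : YoungDiagram, (∀ i, μ.rowLen i = f i) ∧ μ.colLen 0 = r := by
  let μ : YoungDiagram :=
    { cells := (Finset.range r ×ˢ Finset.range (f 0)).filter fun c => c.2 < f c.1
      isLowerSet := by
        rintro ⟨i, j⟩ ⟨i', j'⟩ ⟨hi, hj⟩ h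
        simp only [Finset.coe_filter, Finset.mem_product, Finset.mem_range,
          Set.mem_ofPred_eq] at h ⊢ hi hj
        have := hf hi
        omega }
  have hmem : ∀ i j, (i, j) ∈ μ ↔ j < f i := by
    intro i j
    change (i, j) ∈ (Finset.range r ×ˢ Finset.range (f 0)).filter (fun c => c.2 < f c.1) ↔ _
    simp only [Finset.mem_filter, Finset.mem_product, Finset.mem_range]
    have h1 := hr i
    have h2 := hf (Nat.zero_le i)
    omega
  refine ⟨μ, fun i => eq_of_forall_lt_iff fun j => ?_, eq_of_forall_lt_iff fun i => ?_⟩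
  · rw [← YoungDiagram.mem_iff_lt_rowLen, hmem]
  · rw [← YoungDiagram.mem_iff_lt_colLen, hmem, hr]

theorem exists_betaSet_eq {S : Finset ℕ} (hS : 0 ∉ S) : ∃ μ, betaSet μ = S := by
  set r := S.card with hr
  set e := S.orderEmbOfFin hr.symm with he
  have hstep : ∀ d j : ℕ, ∀ h : j + d < r, e ⟨j, by omega⟩ + d ≤ e ⟨j + d, h⟩ := by
    intro d
    induction d with
    | zero => simp
    | succ d ih =>
      intro j h
      have h1 := ih j (by omega)
      have h2 : e ⟨j + d, by omega⟩ < e ⟨j + (d + 1), h⟩ := e.strictMono (by simp)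
      omega
  have hpos : ∀ k : Fin r, (k : ℕ) < e k := by
    rintro ⟨k, hk⟩
    have h1 := hstep k 0 (by omega)
    have h2 : e ⟨0, by omega⟩ ≠ 0 := fun h => hS (h ▸ S.orderEmbOfFin_mem hr.symm _)
    simp only [zero_add] at h1 ⊢
    omega
  -- The parts are the k-th smallest elements minus k, in reverse order; they are positive because 0
  -- ∉ S.
  let f : ℕ → ℕ := fun i => if h : i < r then e ⟨r - 1 - i, by omega⟩ - (r - 1 - i) else 0
  have hfi : ∀ i (h : i < r), f i + (r - 1 - i) = e ⟨r - 1 - i, by omega⟩ := by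
    intro i h
    have := hpos ⟨r - 1 - i, by omega⟩
    simp only [f, dif_pos h] at this ⊢
    omega
  have hf0 : ∀ i, ¬ i < r → f i = 0 := fun i h => dif_neg h
  have hfpos : ∀ i, 0 < f i ↔ i < r := by
    intro i
    by_cases h : i < r
    · have h1 := hfi i h
      have h2 := hpos ⟨r - 1 - i, by omega⟩
      simp only at h2
      omega
    · simp [hf0 i h, h]
  have hanti : Antitone f := by
    intro i j hij
    by_cases hj : j < r
    · have h1 := hfi i (by omega)
      have h2 := hfi j hj
      have h3 := hstep (j - i) (r - 1 - j) (by omega)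
      simp only [show r - 1 - j + (j - i) = r - 1 - i by omega] at h3
      omega
    · rw [hf0 j hj]
      exact Nat.zero_le _
  obtain ⟨μ, hμ, hμr⟩ := exists_rowLen_eq hanti hfpos
  refine ⟨μ, ?_⟩
  have hsub : betaSet μ ⊆ S := by
    intro m hm
    obtain ⟨i, hi, rfl⟩ := Finset.mem_image.1 hm
    rw [Finset.mem_range, hμr] at hi
    rw [betaNum, hμ, hμr, hfi i hi]
    exact S.orderEmbOfFin_mem hr.symm _
  exact Finset.eq_of_subset_of_card_le hsub (by rw [card_betaSet, hμr])

theorem card_eq_sum_rowLen (μ : YoungDiagram) :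
    μ.card = ∑ i ∈ Finset.range (μ.colLen 0), μ.rowLen i := by
  simp only [YoungDiagram.rowLen_eq_card]
  refine Finset.card_eq_sum_card_fiberwise (f := Prod.fst) ?_
  rintro ⟨i, j⟩ h
  have h' : (i, j) ∈ μ := h
  simp only [Finset.coe_range, Set.mem_Iio]
  exact (YoungDiagram.mem_iff_lt_colLen.1 h').trans_le (μ.colLen_anti 0 j (Nat.zero_le _))

theorem sum_betaSet (μ : YoungDiagram) :
    ∑ s ∈ betaSet μ, s = μ.card + ∑ i ∈ Finset.range (μ.colLen 0), i := by
  rw [betaSet, Finset.sum_image betaNum_injOn, card_eq_sum_rowLen,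
    ← Finset.sum_range_reflect (fun i => i), ← Finset.sum_add_distrib]
  rfl

end BetaSet

/-! ### 3-cores as pairs of natural numbers -/

/-- The set `{1, 4, …, 3a - 2} ∪ {2, 5, …, 3b - 1}`. -/
def coreBetaSet (p : ℕ × ℕ) : Finset ℕ :=
  (Finset.range p.1).image (fun i => 3 * i + 1) ∪ (Finset.range p.2).image (fun i => 3 * i + 2)

theorem coreBetaSet_disjoint (p : ℕ × ℕ) : Disjoint
    ((Finset.range p.1).image fun i => 3 * i + 1) ((Finset.range p.2).image fun i => 3 * i + 2) := by
  rw [Finset.disjoint_left]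
  intro m h1 h2
  simp only [Finset.mem_image] at h1 h2
  obtain ⟨i, -, rfl⟩ := h1
  obtain ⟨j, -, h⟩ := h2
  omega

theorem mem_coreBetaSet {p : ℕ × ℕ} {m : ℕ} : m ∈ coreBetaSet p ↔
    (m % 3 = 1 ∧ m / 3 < p.1) ∨ (m % 3 = 2 ∧ m / 3 < p.2) := by
  simp only [coreBetaSet, Finset.mem_union, Finset.mem_image, Finset.mem_range]
  constructor
  · rintro (⟨i, hi, rfl⟩ | ⟨i, hi, rfl⟩) <;> omega
  · rintro (⟨h, h'⟩ | ⟨h, h'⟩)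
    · exact Or.inl ⟨m / 3, h', by omega⟩
    · exact Or.inr ⟨m / 3, h', by omega⟩

theorem coreBetaSet_injective : Function.Injective coreBetaSet := by
  rintro ⟨a, b⟩ ⟨a', b'⟩ h
  have key : ∀ m, m ∈ coreBetaSet (a, b) ↔ m ∈ coreBetaSet (a', b') := fun m => by rw [h]
  simp only [mem_coreBetaSet] at key
  rw [Prod.mk.injEq]
  constructor <;> refine eq_of_forall_lt_iff fun i => ?_
  · have := key (3 * i + 1)
    omega
  · have := key (3 * i + 2)
    omega

/-- Each runner of the 3-abacus is an initial segment, being finite and closed under moving down. -/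
theorem exists_mem_iff_lt {S : Finset ℕ} (hS : ∀ m, m + 3 ∈ S → m ∈ S) (c : ℕ) :
    ∃ a, ∀ i, 3 * i + c ∈ S ↔ i < a := by
  classical
  have hex : ∃ i, 3 * i + c ∉ S := by
    refine ⟨S.sup id + 1, fun h => ?_⟩
    have := Finset.le_sup (f := id) h
    simp only [id] at this
    omega
  refine ⟨Nat.find hex, fun i => ⟨fun h => ?_, fun h => by simpa using Nat.find_min hex h⟩⟩
  by_contra! hle
  have key : ∀ d j, 3 * (j + d) + c ∈ S → 3 * j + c ∈ S := by
    intro d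
    induction d with
    | zero => simp
    | succ d ih =>
      intro j h
      exact ih j (hS _ (by convert h using 1; ring))
  refine Nat.find_spec hex (key (i - Nat.find hex) _ ?_)
  rwa [Nat.add_sub_cancel' hle]

theorem exists_coreBetaSet_eq {S : Finset ℕ} (h0 : 0 ∉ S) (hS : ∀ m, m + 3 ∈ S → m ∈ S) :
    ∃ p, coreBetaSet p = S := by
  obtain ⟨z, hz⟩ := exists_mem_iff_lt hS 0
  obtain ⟨a, ha⟩ := exists_mem_iff_lt hS 1
  obtain ⟨b, hb⟩ := exists_mem_iff_lt hS 2
  refine ⟨(a, b), ?_⟩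
  ext m
  rw [mem_coreBetaSet]
  -- The runner of multiples of 3 is empty because 0 is never a beta number.
  have hz0 : z = 0 := by
    have := hz 0
    simp only [mul_zero, add_zero, h0, false_iff] at this
    omega
  have h1 := hz (m / 3)
  have h2 := ha (m / 3)
  have h3 := hb (m / 3)
  rcases (by omega : m % 3 = 0 ∨ m % 3 = 1 ∨ m % 3 = 2) with h | h | h
  · rw [show 3 * (m / 3) + 0 = m by omega] at h1
    rw [h1]
    omega
  · rw [show 3 * (m / 3) + 1 = m by omega] at h2
    rw [h2]
    omega
  · rw [show 3 * (m / 3) + 2 = m by omega] at h3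
    rw [h3]
    omega

/-- The size of the `3`-core with beta set `coreBetaSet p`. -/
def coreSize (p : ℕ × ℕ) : ℕ := p.1 ^ 2 + p.2 ^ 2 + p.2 - p.1 * p.2

theorem coreSize_cast (p : ℕ × ℕ) :
    (coreSize p : ℤ) = p.1 ^ 2 + p.2 ^ 2 + p.2 - p.1 * p.2 := by
  have : p.1 * p.2 ≤ p.1 ^ 2 + p.2 ^ 2 + p.2 := by
    zify
    nlinarith [sq_nonneg ((p.1 : ℤ) - p.2)]
  rw [coreSize, Nat.cast_sub this]
  push_cast
  ring

theorem two_mul_sum_range_id (n : ℕ) : 2 * (∑ i ∈ Finset.range n, (i : ℤ)) = n ^ 2 - n := by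
  induction n with
  | zero => simp
  | succ n ih =>
    rw [Finset.sum_range_succ, mul_add, ih]
    push_cast
    ring

theorem two_mul_sum_coreBetaSet (p : ℕ × ℕ) :
    2 * (∑ s ∈ coreBetaSet p, (s : ℤ)) = 3 * p.1 ^ 2 - p.1 + 3 * p.2 ^ 2 + p.2 := by
  rw [coreBetaSet, Finset.sum_union (coreBetaSet_disjoint p),
    Finset.sum_image (fun i _ j _ h => by omega), Finset.sum_image (fun i _ j _ h => by omega)]
  push_cast
  rw [Finset.sum_add_distrib, Finset.sum_add_distrib, ← Finset.mul_sum, ← Finset.mul_sum]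
  simp only [Finset.sum_const, Finset.card_range, nsmul_eq_mul]
  linear_combination 3 * two_mul_sum_range_id p.1 + 3 * two_mul_sum_range_id p.2

theorem card_coreBetaSet (p : ℕ × ℕ) : (coreBetaSet p).card = p.1 + p.2 := by
  rw [coreBetaSet, Finset.card_union_of_disjoint (coreBetaSet_disjoint p),
    Finset.card_image_of_injective _ (fun i j h => by simpa using h),
    Finset.card_image_of_injective _ (fun i j h => by simpa using h), Finset.card_range,
    Finset.card_range]

theorem card_eq_coreSize {μ : YoungDiagram} {p : ℕ × ℕ} (h : betaSet μ = coreBetaSet p) :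
    μ.card = coreSize p := by
  have h1 := sum_betaSet μ
  have h2 : μ.colLen 0 = p.1 + p.2 := by rw [← card_betaSet, h, card_coreBetaSet]
  have h3 := two_mul_sum_coreBetaSet p
  have h4 := two_mul_sum_range_id (p.1 + p.2)
  rw [h, h2] at h1
  zify at h1 ⊢
  rw [coreSize_cast]
  push_cast at h4
  linarith

theorem exists_bijOn_isCore : ∃ φ : ℕ × ℕ → YoungDiagram,
    Set.BijOn φ Set.univ {μ | IsCore 3 μ} ∧ ∀ p, (φ p).card = coreSize p := by
  have hex : ∀ p, ∃ μ, betaSet μ = coreBetaSet p := fun p =>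
    exists_betaSet_eq (by simp [mem_coreBetaSet])
  choose φ hφ using hex
  refine ⟨φ, ⟨?_, ?_, ?_⟩, fun p => card_eq_coreSize (hφ p)⟩
  · intro p _
    refine isCore_iff.2 fun m => ?_
    rw [hφ, mem_coreBetaSet, mem_coreBetaSet]
    omega
  · intro p _ q _ h
    exact coreBetaSet_injective (by rw [← hφ, ← hφ, h])
  · intro μ hμ
    obtain ⟨p, hp⟩ := exists_coreBetaSet_eq (zero_notMem_betaSet μ) (isCore_iff.1 hμ)
    exact ⟨p, Set.mem_univ _, betaSet_injective ((hφ p).trans hp)⟩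

/-! ### 3-cores as Eisenstein integers -/

theorem finite_fibers_coreSize (n : ℕ) : {p | 3 * coreSize p + 1 = n}.Finite := by
  refine ((Set.finite_Iic (2 * n)).prod (Set.finite_Iic (2 * n))).subset ?_
  rintro ⟨a, b⟩ rfl
  have h := coreSize_cast (a, b)
  simp only [Set.mem_prod, Set.mem_Iic] at h ⊢
  zify
  rw [h]
  constructor <;>
    nlinarith [sq_nonneg ((a : ℤ) - b), sq_nonneg ((a : ℤ) - 1), sq_nonneg ((b : ℤ) - 1)]

/-- The elements of `lat 1` in a fundamental sector for multiplication by `ω`. -/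
def sector : Set (ℤ × ℤ) :=
  {v | (v.1 + v.2 - 1) % 3 = 0 ∧ 0 < v.1 - 2 * v.2 ∧ v.2 - 2 * v.1 < 0}

theorem theta_sector :
    theta Set.univ (fun p => 3 * coreSize p + 1) = theta sector normForm := by
  -- The solution of x - 2y = 3a + 1, 2x - y = 3b + 2; the two sector inequalities say exactly that
  -- a, b ≥ 0.
  refine theta_eq_of_bijOn (fun p => (2 * (p.2 : ℤ) - p.1 + 1, (p.2 : ℤ) - 2 * p.1))
    ⟨?_, ?_, ?_⟩ ?_
  · rintro ⟨a, b⟩ -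
    simp only [sector, Set.mem_ofPred_eq]
    omega
  · rintro ⟨a, b⟩ - ⟨a', b'⟩ - h
    simp only [Prod.mk.injEq] at h ⊢
    omega
  · rintro ⟨x, y⟩ h
    simp only [sector, Set.mem_ofPred_eq] at h
    refine ⟨(((x - 2 * y) / 3).toNat, ((2 * x - y) / 3).toNat), Set.mem_univ _, ?_⟩
    simp only [Prod.mk.injEq]
    omega
  · rintro p -
    zify
    rw [normForm_cast, coreSize_cast]
    ring

/-- The forms x - 2y, y - 2x and x + y sum to zero and are all 1 modulo 3 on `lat 1`. None vanishes
there, so exactly one of the three sign patterns occurs, and ω permutes the patterns. -/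
theorem latTheta_one_eq :
    latTheta 1 = 3 * theta Set.univ (fun p => 3 * coreSize p + 1) := by
  have h := theta_eq_add_three_mul normForm_finite rot normForm_rot (S := lat 1) (S₀ := ∅)
    (S₁ := sector)
    (S₂ := {v | (v.1 + v.2 - 1) % 3 = 0 ∧ 0 < v.1 + v.2 ∧ v.1 - 2 * v.2 < 0})
    (S₃ := {v | (v.1 + v.2 - 1) % 3 = 0 ∧ 0 < v.2 - 2 * v.1 ∧ v.1 + v.2 < 0})
    ⟨?_, ?_, ?_⟩ ⟨?_, ?_, ?_⟩ ?_ ?_ ?_ ?_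
  · rw [latTheta, h, theta_sector, add_eq_right]
    ext n
    simp [coeff_theta]
  · rintro ⟨x, y⟩ h
    simp only [sector, rot, Set.mem_ofPred_eq] at h ⊢
    omega
  · rintro ⟨x, y⟩ - ⟨x', y'⟩ - h
    simp only [rot, Prod.mk.injEq] at h ⊢
    omega
  · rintro ⟨x, y⟩ h
    simp only [Set.mem_ofPred_eq] at h
    refine ⟨(y - x, -x), ?_, ?_⟩
    · simp only [sector, Set.mem_ofPred_eq]
      omega
    · simp only [rot, Prod.mk.injEq]
      omega
  · rintro ⟨x, y⟩ h
    simp only [rot, Set.mem_ofPred_eq] at h ⊢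
    omega
  · rintro ⟨x, y⟩ - ⟨x', y'⟩ - h
    simp only [rot, Prod.mk.injEq] at h ⊢
    omega
  · rintro ⟨x, y⟩ h
    simp only [Set.mem_ofPred_eq] at h
    refine ⟨(y - x, -x), ?_, ?_⟩
    · simp only [Set.mem_ofPred_eq]
      omega
    · simp only [rot, Prod.mk.injEq]
      omega
  · ext ⟨x, y⟩
    simp only [sector, lat, Set.mem_union, Set.mem_ofPred_eq, Set.mem_empty_iff_false,
      false_or]
    omega
  · exact Set.empty_disjoint _
  all_goals
    rw [Set.disjoint_left]
    rintro ⟨x, y⟩ h h'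
    simp only [sector, Set.mem_union, Set.mem_ofPred_eq, Set.mem_empty_iff_false, false_or] at h h'
    omega

/-! ### Counting triples and the exact identity -/

theorem B_eq_ncard (n : ℕ) : B 3 n =
    {p : (ℕ × ℕ) × (ℕ × ℕ) × (ℕ × ℕ) |
      coreSize p.1 + (coreSize p.2.1 + coreSize p.2.2) = n}.ncard := by
  obtain ⟨φ, ⟨hmaps, hinj, hsurj⟩, hcard⟩ := exists_bijOn_isCore
  refine (Set.BijOn.ncard_eq (f := fun p => ![φ p.1, φ p.2.1, φ p.2.2]) ⟨?_, ?_, ?_⟩).symm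
  · rintro ⟨p, q, r⟩ h
    simp only [Set.mem_ofPred_eq] at h
    refine ⟨?_, ?_⟩
    · simp only [Fin.sum_univ_three, Matrix.cons_val, hcard]
      omega
    · intro i
      fin_cases i <;> exact hmaps (Set.mem_univ _)
  · rintro ⟨p, q, r⟩ - ⟨p', q', r'⟩ - h
    have h0 := congrFun h 0
    have h1 := congrFun h 1
    have h2 := congrFun h 2
    simp only [Matrix.cons_val] at h0 h1 h2
    rw [hinj (Set.mem_univ _) (Set.mem_univ _) h0, hinj (Set.mem_univ _) (Set.mem_univ _) h1,
      hinj (Set.mem_univ _) (Set.mem_univ _) h2]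
  · rintro μ ⟨hsum, hcore⟩
    obtain ⟨p, -, hp⟩ := hsurj (hcore 0)
    obtain ⟨q, -, hq⟩ := hsurj (hcore 1)
    obtain ⟨r, -, hr⟩ := hsurj (hcore 2)
    refine ⟨(p, q, r), ?_, ?_⟩
    · rw [Fin.sum_univ_three, ← hp, ← hq, ← hr, hcard, hcard, hcard] at hsum
      simp only [Set.mem_ofPred_eq]
      omega
    · ext1 i
      fin_cases i
      · exact hp
      · exact hq
      · exact hr

theorem coeff_latTheta_one_pow_three (n : ℕ) :
    coeff (3 * (n + 1)) (latTheta 1 ^ 3) = 27 * (B 3 n : ℤ) := by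
  have h : latTheta 1 ^ 3 = (27 : ℕ) • theta (Set.univ ×ˢ (Set.univ ×ˢ Set.univ))
      (fun p => (3 * coreSize p.1 + 1) + ((3 * coreSize p.2.1 + 1) + (3 * coreSize p.2.2 + 1))) := by
    rw [← theta_mul finite_fibers_coreSize
        (finite_fibers_add finite_fibers_coreSize finite_fibers_coreSize) Set.univ
        (Set.univ ×ˢ Set.univ),
      ← theta_mul finite_fibers_coreSize finite_fibers_coreSize Set.univ Set.univ,
      latTheta_one_eq, nsmul_eq_mul]
    push_cast
    ring
  rw [h, map_nsmul, coeff_theta, B_eq_ncard, nsmul_eq_mul]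
  push_cast
  congr 3
  ext p
  simp only [Set.mem_prod, Set.mem_univ, Set.mem_ofPred_eq, true_and]
  omega

theorem five_mul_B (k n : ℕ) : 5 * (B 3 (2 ^ (k + 1) * n + (2 ^ k - 1)) : ℤ) =
    (4 ^ (k + 1) + (-1) ^ k) * B 3 (2 * n) := by
  -- With this m, 2^k m = 3(N + 1) for the index N in the statement, while k = 0 corresponds to the
  -- index 2n.
  have h := five_mul_coeff_latTheta_pow_three (m := 3 * (2 * n + 1)) (by
    rw [Nat.odd_mul]
    exact ⟨by decide, n, rfl⟩) k
  have hk : 2 ^ k * (3 * (2 * n + 1)) = 3 * (2 ^ (k + 1) * n + (2 ^ k - 1) + 1) := by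
    rw [add_assoc, Nat.sub_add_cancel Nat.one_le_two_pow]
    ring
  rw [hk, coeff_latTheta_one_pow_three, coeff_latTheta_one_pow_three] at h
  linarith

theorem five_dvd_four_pow_add (k : ℕ) : (5 : ℤ) ∣ 4 ^ (k + 1) + (-1) ^ k := by
  have h := sub_dvd_pow_sub_pow (4 : ℤ) (-1) (k + 1)
  rw [show (4 : ℤ) - -1 = 5 by norm_num, pow_succ (-1 : ℤ)] at h
  simpa using h

end PartitionTriples

theorem mainTheorem2 (k n : ℕ) (hk : 1 ≤ k) :
    (5 : ℤ) ∣ 4 ^ (k + 1) + (-1) ^ k ∧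
      (PartitionTriples.B 3 (2 ^ (k + 1) * n + (2 ^ k - 1)) : ℤ) ≡ 0
        [ZMOD (4 ^ (k + 1) + (-1) ^ k) / 5] := by
  have h5 := PartitionTriples.five_dvd_four_pow_add k
  refine ⟨h5, Int.modEq_zero_iff_dvd.2 ?_⟩
  have h := PartitionTriples.five_mul_B k n
  obtain ⟨M, hM⟩ := h5
  rw [hM, Int.mul_ediv_cancel_left _ (by norm_num : (5 : ℤ) ≠ 0)]
  rw [hM, mul_assoc] at h
  exact ⟨_, mul_left_cancel₀ (by norm_num) h⟩
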